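/- An average hard attention transformer encoder (AHAT) is a finite composition of encoder layers; a layer maps each finite sequence $v_0,\dots,v_{n-1}\in\mathbb R^d$ ($n\ge 1$) to a sequence $v'_0,\dots,v'_{n-1}\in\mathbb R^e$ of the same length, and is of one of two kinds. (1) A standard layer is given by affine maps $A,B:\mathbb R^d\to\mathbb R^d$ and $C:\mathbb R^{2d}\to\mathbb R^e$: for each $i$ let $S_i$ be the set of positions $j\in\{0,\dots,n-1\}$ (or, if the layer uses future positional masking, $j\in\{0,\dots,i\}$) that maximize $\langle Av_i,Bv_j\rangle$, let $a_i=\frac1{|S_i|}\sum_{j\in S_i}v_j$, and set $v'_i=C(v_i,a_i)$. (2) A ReLU layer is given by $k\in\{1,\dots,d\}$ (with $e=d$) and replaces the $k$-th coordinate $v_i^k$ of each $v_i$ by $\max\{0,v_i^k\}$. An AHAT $T$ from $\mathbb R^d$ to $\mathbb R^e$ accepts a language $L$ over a finite alphabet $\Sigma$ if there are $f:\Sigma\to\mathbb R^d$, $p:\mathbb N\times\mathbb N\to\mathbb R^d$ and $t\in\mathbb R^e$ such that for every nonempty word $w=a_0\cdots a_{n-1}\in\Sigma^+$, where $v_0,\dots,v_{n-1}$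 denotes the output of $T$ on $f(a_0)+p(0,n),\dots,f(a_{n-1})+p(n-1,n)$, one has $\langle t,v_0\rangle>0$ if $w\in L$ and $\langle t,v_0\rangle<0$ if $w\notin L$. (The empty word plays no role.) The permutation closure $\mathrm{perm}(L)$ is the set of words $w$ for which some $v\in L$ contains each letter of $\Sigma$ exactly as often as $w$; a language $L$ is permutation-closed if, for every word $v$, $v\in L$ if and only if every letter-permutation of $v$ is in $L$. Theorem. (i) For every finite alphabet $\Sigma$ and every regular language $L$ over $\Sigma$, the language $\mathrm{perm}(L)$ is accepted by an AHAT. (ii) Every permutation-closed language over a two-letter alphabet is accepted by an AHAT. In particular, for each letter $a$ of a two-letter alphabet, the language parity (words in which $a$ occurs an even number of times) and the language majority (words in which more than half of the positions are labeled by $a$) are accepted by AHATs. -/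

import Mathlib

noncomputable section

namespace HardAttention

/-- The attention score of position `j` from position `i`: the standard inner product of `A vᵢ`
and `B vⱼ`. -/
def score {d n : ℕ} (A B : (Fin d → ℝ) →ᵃ[ℝ] (Fin d → ℝ)) (v : Fin n → (Fin d → ℝ))
    (i j : Fin n) : ℝ :=
  A (v i) ⬝ᵥ B (v j)

/-- The positions visible from position `i`: all of them, or only `0, …, i` if future positional
masking is used. -/
def visible {n : ℕ} (masked : Bool) (i : Fin n) : Finset (Fin n) :=
  if masked then Finset.Iic i else Finset.univ

open Classical in
/-- The set `Sᵢ` of visible positions that maximize the attention score from position `i`. -/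
def maximizers {d n : ℕ} (masked : Bool) (A B : (Fin d → ℝ) →ᵃ[ℝ] (Fin d → ℝ))
    (v : Fin n → (Fin d → ℝ)) (i : Fin n) : Finset (Fin n) :=
  {j ∈ visible masked i | ∀ k ∈ visible masked i, score A B v i k ≤ score A B v i j}

/-- The attention vector `aᵢ`: the uniform average of `vⱼ` over the maximizing positions `j`. -/
def averageAttention {d n : ℕ} (masked : Bool) (A B : (Fin d → ℝ) →ᵃ[ℝ] (Fin d → ℝ))
    (v : Fin n → (Fin d → ℝ)) (i : Fin n) : Fin d → ℝ :=
  ((maximizers masked A B v i).card : ℝ)⁻¹ • ∑ j ∈ maximizers masked A B v i, v j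

/-- Encoder layers from sequences of vectors in `ℝᵈ` to sequences of vectors in `ℝᵉ`: standard
layers with average hard attention (with or without future positional masking), and layers that
apply ReLU to one coordinate. -/
inductive Layer : ℕ → ℕ → Type
  | standard {d e : ℕ} (masked : Bool) (A B : (Fin d → ℝ) →ᵃ[ℝ] (Fin d → ℝ))
      (C : (Fin d → ℝ) × (Fin d → ℝ) →ᵃ[ℝ] (Fin e → ℝ)) : Layer d e
  | relu {d : ℕ} (k : Fin d) : Layer d d

/-- The length-preserving map on sequences of vectors computed by a layer. -/
def Layer.apply {n : ℕ} : {d e : ℕ} → Layer d e → (Fin n → (Fin d → ℝ)) → (Fin n → (Fin e → ℝ))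
  | _, _, .standard masked A B C, v => fun i => C (v i, averageAttention masked A B v i)
  | _, _, .relu k, v => fun i => Function.update (v i) k (max 0 (v i k))

/-- An average hard attention transformer encoder: a finite composition of encoder layers. -/
inductive AHAT : ℕ → ℕ → Type
  | nil (d : ℕ) : AHAT d d
  | cons {d e f : ℕ} (ℓ : Layer d e) (T : AHAT e f) : AHAT d f

/-- The map on sequences of vectors computed by an encoder (first layer first). -/
def AHAT.apply {n : ℕ} : {d e : ℕ} → AHAT d e → (Fin n → (Fin d → ℝ)) → (Fin n → (Fin e → ℝ))
  | _, _, .nil _, v => v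
  | _, _, .cons ℓ T, v => T.apply (ℓ.apply v)

/-- The value of an encoder `T` on a nonempty word `w = a₀ ⋯ aₙ₋₁`, for the embedding `f`, the
positional encoding `p` and the output vector `t`: the inner product of `t` with the first vector
of the output of `T` on `f(a₀) + p(0, n), …, f(aₙ₋₁) + p(n - 1, n)`. -/
def AHAT.value {α : Type*} {d e : ℕ} (T : AHAT d e) (f : α → (Fin d → ℝ))
    (p : ℕ → ℕ → (Fin d → ℝ)) (t : Fin e → ℝ) (w : List α) (hw : w ≠ []) : ℝ :=
  t ⬝ᵥ T.apply (fun i : Fin w.length => f (w.get i) + p i w.length)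
    ⟨0, List.length_pos_of_ne_nil hw⟩

/-- `T` accepts `L`. Only nonempty words are given to an encoder, so the empty word plays no role
in acceptance. -/
def AHAT.Accepts {α : Type*} {d e : ℕ} (T : AHAT d e) (L : Language α) : Prop :=
  ∃ (f : α → (Fin d → ℝ)) (p : ℕ → ℕ → (Fin d → ℝ)) (t : Fin e → ℝ),
    ∀ (w : List α) (hw : w ≠ []),
      (w ∈ L → 0 < T.value f p t w hw) ∧ (w ∉ L → T.value f p t w hw < 0)

/-- `L` is accepted by some average hard attention transformer encoder. -/
def AcceptedByAHAT {α : Type*} (L : Language α) : Prop :=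
  ∃ (d e : ℕ) (T : AHAT d e), T.Accepts L

/-- The Parikh vector of a word: the number of occurrences of each letter. -/
def parikh {α : Type*} [DecidableEq α] (w : List α) : α → ℕ :=
  fun a => w.count a

/-- The permutation closure of `L`. -/
def perm {α : Type*} [DecidableEq α] (L : Language α) : Language α :=
  {w : List α | ∃ v ∈ L, parikh w = parikh v}

/-- `L` is permutation-closed: a word is in `L` iff all its letter-permutations are in `L`. -/
def PermutationClosed {α : Type*} (L : Language α) : Prop :=
  ∀ v : List α, v ∈ L ↔ ∀ w : List α, w.Perm v → w ∈ L

/-- The words in which the letter `a` occurs an even number of times. -/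
def parity {α : Type*} [DecidableEq α] (a : α) : Language α :=
  {w : List α | Even (w.count a)}

/-- The words in which the majority (more than half) of the positions are labeled by `a`. -/
def majority {α : Type*} [DecidableEq α] (a : α) : Language α :=
  {w : List α | w.length < 2 * w.count a}

end HardAttention

end

/-!
The argument has two halves.

*What encoders compute.* A feature assigns a real number to each position of each word. Layers can
carry along additional coordinates (`AHAT.carry`), so any number of features can be computed by one
encoder, and the realizable features (`Realizable`) contain all functions of the letter and all
positional encodings, and are closed under affine combinations, ReLU and attention with scores
`a i * b j + c j`. Hence the properties of words that are decided by the sign of a realizable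
feature (`Recognizable`) form a Boolean algebra, conjunction being `min x y = x - max 0 (x - y)`.
Two kinds of properties generate all that is needed. Uniform attention computes the frequencies
`count a / n`, whence linear inequalities between letter counts (`recognizable_linear_pos`). And
attention with the score `2 * count a * m - m ^ 2`, where `m` runs over the positions, has its
unique maximum at `m = count a`; so it can look up an arbitrary bit stored there by the positional
encoding (`recognizable_count`). Over two letters the count of one letter and the length determine
a word up to permutation, so this already gives all permutation-closed languages.

*Regular languages.* Kleene's recursion on the set of allowed intermediate states of a finite
automaton shows that the letter counts of the words of a regular language form a semilinear set
(`isSemilinearSet_parikh_image`). Such a set is a finite union of linear sets with linearly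
independent periods. For independent periods, the coefficients of a vector are rational linear
forms, so membership is a conjunction of linear equations, linear inequalities, and divisibility
conditions (`recognizable_of_isProperLinearSet`); the latter depend only on the residues of the
letter counts, which can be looked up.
-/

noncomputable section

namespace HardAttention

variable {α : Type*}

/-! ### Extending encoders -/

/-- The affine map whose first coordinate is `ℓ` and whose remaining coordinates are those of
`g`. -/
def affineCons {V : Type*} [AddCommGroup V] [Module ℝ V] {n : ℕ} (ℓ : V →ᵃ[ℝ] ℝ)
    (g : V →ᵃ[ℝ] (Fin n → ℝ)) : V →ᵃ[ℝ] (Fin (n + 1) → ℝ) :=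
  AffineMap.pi (Fin.cons ℓ fun k => (LinearMap.proj k).toAffineMap.comp g)

@[simp]
theorem affineCons_apply {V : Type*} [AddCommGroup V] [Module ℝ V] {n : ℕ} (ℓ : V →ᵃ[ℝ] ℝ)
    (g : V →ᵃ[ℝ] (Fin n → ℝ)) (v : V) : affineCons ℓ g v = Matrix.vecCons (ℓ v) (g v) := by
  ext k
  refine Fin.cases ?_ (fun k => ?_) k <;> simp [affineCons]

/-- Forgetting the first coordinate. -/
def affineTail (n : ℕ) : (Fin (n + 1) → ℝ) →ᵃ[ℝ] (Fin n → ℝ) :=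
  (LinearMap.funLeft ℝ ℝ Fin.succ).toAffineMap

theorem affineTail_apply {n : ℕ} (v : Fin (n + 1) → ℝ) :
    affineTail n v = fun k => v k.succ := rfl

@[simp]
theorem affineTail_vecCons {n : ℕ} (x : ℝ) (v : Fin n → ℝ) :
    affineTail n (Matrix.vecCons x v) = v := by
  ext k
  simp [affineTail, LinearMap.funLeft_apply]

/-- Affine maps commute with uniform averages. Thus attention may be applied to affine readouts of
the vectors instead of the vectors themselves. -/
theorem affineMap_average {V W ι : Type*} [AddCommGroup V] [Module ℝ V] [AddCommGroup W]
    [Module ℝ W] (ℓ : V →ᵃ[ℝ] W) {s : Finset ι} (hs : s.Nonempty) (v : ι → V) :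
    ℓ ((s.card : ℝ)⁻¹ • ∑ j ∈ s, v j) = (s.card : ℝ)⁻¹ • ∑ j ∈ s, ℓ (v j) := by
  have hc : (s.card : ℝ) ≠ 0 := by exact_mod_cast hs.card_ne_zero
  rw [ℓ.decomp]
  simp only [Pi.add_apply, map_smul, map_sum, Finset.sum_add_distrib, Finset.sum_const, smul_add,
    ← Nat.cast_smul_eq_nsmul ℝ, smul_smul, inv_mul_cancel₀ hc, one_smul]

theorem mem_maximizers {d n : ℕ} {masked : Bool} {A B : (Fin d → ℝ) →ᵃ[ℝ] (Fin d → ℝ)}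
    {v : Fin n → (Fin d → ℝ)} {i j : Fin n} : j ∈ maximizers masked A B v i ↔
      j ∈ visible masked i ∧ ∀ k ∈ visible masked i, score A B v i k ≤ score A B v i j := by
  simp [maximizers]

theorem maximizers_nonempty {d n : ℕ} (masked : Bool) (A B : (Fin d → ℝ) →ᵃ[ℝ] (Fin d → ℝ))
    (v : Fin n → (Fin d → ℝ)) (i : Fin n) : (maximizers masked A B v i).Nonempty := by
  have hv : (visible masked i).Nonempty := ⟨i, by cases masked <;> simp [visible]⟩
  obtain ⟨j, hj, hmax⟩ := (visible masked i).exists_max_image (score A B v i) hv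
  exact ⟨j, mem_maximizers.2 ⟨hj, hmax⟩⟩

/-- The layer that acts on all coordinates but the first as the given one, and keeps the first. -/
def Layer.carry : {d e : ℕ} → Layer d e → Layer (d + 1) (e + 1)
  | d, _, .standard masked A B C =>
    .standard masked (affineCons (AffineMap.const ℝ _ 0) (A.comp (affineTail d)))
      (affineCons (AffineMap.const ℝ _ 0) (B.comp (affineTail d)))
      (affineCons ((LinearMap.proj 0).toAffineMap.comp AffineMap.fst)
        (C.comp ((affineTail d).prodMap (affineTail d))))
  | _, _, .relu k => .relu k.succ

theorem Layer.carry_apply {n d e : ℕ} (T : Layer d e) (x : Fin n → ℝ) (v : Fin n → (Fin d → ℝ)) :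
    T.carry.apply (fun i => Matrix.vecCons (x i) (v i)) =
      fun i => Matrix.vecCons (x i) (T.apply v i) := by
  cases T with
  | standard masked A B C =>
    funext i
    have hmax : maximizers masked (affineCons (AffineMap.const ℝ _ 0) (A.comp (affineTail d)))
        (affineCons (AffineMap.const ℝ _ 0) (B.comp (affineTail d)))
        (fun i => Matrix.vecCons (x i) (v i)) i = maximizers masked A B v i := by
      ext j
      simp [mem_maximizers, score]
    simp only [Layer.carry, Layer.apply, affineCons_apply]
    congr 1
    simp only [AffineMap.comp_apply, AffineMap.prodMap_apply, affineTail_vecCons, averageAttention,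
      hmax, affineMap_average _ (maximizers_nonempty _ _ _ _ _)]
  | relu k =>
    funext i l
    refine Fin.cases ?_ (fun l => ?_) l
    · simp [Layer.carry, Layer.apply, (Fin.succ_ne_zero k).symm]
    · simp [Layer.carry, Layer.apply, Function.update_apply]

/-- The encoder that acts on all coordinates but the first as the given one, and keeps the first. -/
def AHAT.carry : {d e : ℕ} → AHAT d e → AHAT (d + 1) (e + 1)
  | _, _, .nil d => .nil (d + 1)
  | _, _, .cons ℓ T => .cons ℓ.carry T.carry

theorem AHAT.carry_apply {n d e : ℕ} (T : AHAT d e) (x : Fin n → ℝ) (v : Fin n → (Fin d → ℝ)) :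
    T.carry.apply (fun i => Matrix.vecCons (x i) (v i)) =
      fun i => Matrix.vecCons (x i) (T.apply v i) := by
  induction T with
  | nil d => rfl
  | cons ℓ T ih => simp only [AHAT.carry, AHAT.apply, Layer.carry_apply, ih]

/-- The encoder `T` followed by one more layer. -/
def AHAT.snoc : {d e f : ℕ} → AHAT d e → Layer e f → AHAT d f
  | _, _, _, .nil _, ℓ => .cons ℓ (.nil _)
  | _, _, _, .cons ℓ' T, ℓ => .cons ℓ' (T.snoc ℓ)

@[simp]
theorem AHAT.snoc_apply {n d e f : ℕ} (T : AHAT d e) (ℓ : Layer e f) (v : Fin n → (Fin d → ℝ)) :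
    (T.snoc ℓ).apply v = ℓ.apply (T.apply v) := by
  induction T with
  | nil d => rfl
  | cons ℓ' T ih => simp only [AHAT.snoc, AHAT.apply, ih]

/-! ### Features computed by encoders -/

variable (α) in
/-- A real number at each position of each word. -/
abbrev Feature := (w : List α) → Fin w.length → ℝ

/-- The input `f(a₀) + p(0, n), …, f(aₙ₋₁) + p(n - 1, n)` of an encoder. -/
def embed {d : ℕ} (f : α → (Fin d → ℝ)) (p : ℕ → ℕ → (Fin d → ℝ)) (w : List α) :
    Fin w.length → (Fin d → ℝ) :=
  fun i => f (w.get i) + p i w.length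

/-- All features in `S` can be read off, by affine functionals, from the output of a single
encoder. The output dimension is at least `2`, so that the attention scores of one further layer
have room for two terms. -/
def JointlyComputable (S : Set (Feature α)) : Prop :=
  ∃ (d e : ℕ) (T : AHAT d (e + 2)) (f : α → (Fin d → ℝ)) (p : ℕ → ℕ → (Fin d → ℝ)),
    ∀ F ∈ S, ∃ ℓ : (Fin (e + 2) → ℝ) →ᵃ[ℝ] ℝ,
      ∀ (w : List α) (i : Fin w.length), F w i = ℓ (T.apply (embed f p w) i)

theorem JointlyComputable.mono {S S' : Set (Feature α)} (h : JointlyComputable S) (hS : S' ⊆ S) :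
    JointlyComputable S' := by
  obtain ⟨d, e, T, f, p, h⟩ := h
  exact ⟨d, e, T, f, p, fun F hF => h F (hS hF)⟩

theorem jointlyComputable_empty : JointlyComputable (∅ : Set (Feature α)) :=
  ⟨2, 0, .nil 2, 0, 0, by simp⟩

/-- A feature is realizable if it can be added to every jointly computable set of features.
Unlike computability by some encoder, this is visibly preserved when several features are
combined. -/
def Realizable (F : Feature α) : Prop :=
  ∀ S : Set (Feature α), JointlyComputable S → JointlyComputable (insert F S)

/-- The sum of a function of the letter and a positional encoding is realizable: it becomes an
additional input coordinate that all layers carry along. -/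
theorem realizable_input (φ : α → ℝ) (ψ : ℕ → ℕ → ℝ) :
    Realizable fun w i => φ (w.get i) + ψ i w.length := by
  rintro S ⟨d, e, T, f, p, h⟩
  refine ⟨d + 1, e + 1, T.carry, fun a => Matrix.vecCons (φ a) (f a),
    fun i n => Matrix.vecCons (ψ i n) (p i n), ?_⟩
  have key (w : List α) : embed (fun a => Matrix.vecCons (φ a) (f a))
      (fun i n => Matrix.vecCons (ψ i n) (p i n)) w =
      fun i => Matrix.vecCons (φ (w.get i) + ψ i w.length) (embed f p w i) := by
    funext i
    simp [embed]
  simp only [key, AHAT.carry_apply]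
  rintro F (rfl | hF)
  · exact ⟨(LinearMap.proj 0).toAffineMap, fun w i => by simp⟩
  · obtain ⟨ℓ, hℓ⟩ := h F hF
    exact ⟨ℓ.comp (affineTail _), fun w i => by simp [hℓ]⟩

theorem JointlyComputable.insert_affine {S : Set (Feature α)} (h : JointlyComputable S)
    {F G : Feature α} (hF : F ∈ S) (hG : G ∈ S) (x y z : ℝ) :
    JointlyComputable (insert (fun w i => x * F w i + y * G w i + z) S) := by
  obtain ⟨d, e, T, f, p, h⟩ := h
  refine ⟨d, e, T, f, p, ?_⟩
  rintro H (rfl | hH)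
  · obtain ⟨ℓF, hF⟩ := h F hF
    obtain ⟨ℓG, hG⟩ := h G hG
    exact ⟨x • ℓF + y • ℓG + AffineMap.const ℝ _ z, fun w i => by simp [hF, hG]⟩
  · exact h H hH

theorem JointlyComputable.insert_relu {S : Set (Feature α)} (h : JointlyComputable S)
    {F : Feature α} (hF : F ∈ S) :
    JointlyComputable (insert (fun w i => max 0 (F w i)) S) := by
  obtain ⟨d, e, T, f, p, h⟩ := h
  obtain ⟨ℓ, hℓ⟩ := h F hF
  refine ⟨d, e + 1, (T.snoc (.standard false 0 0 ((affineCons ℓ (AffineMap.id ℝ _)).comp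
    AffineMap.fst))).snoc (.relu 0), f, p, ?_⟩
  rintro H (rfl | hH)
  · exact ⟨(LinearMap.proj 0).toAffineMap, fun w i => by simp [Layer.apply, hℓ]⟩
  · obtain ⟨ℓH, hH⟩ := h H hH
    exact ⟨ℓH.comp (affineTail _), fun w i => by
      simp [Layer.apply, hH, affineTail_apply]⟩

open Classical in
/-- The average of `G` over the positions `j` that maximize `a i * b j + c j`. -/
def attend (a b c G : Feature α) : Feature α := fun w i =>
  let M : Finset (Fin w.length) :=
    {j | ∀ k, a w i * b w k + c w k ≤ a w i * b w j + c w j}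
  (M.card : ℝ)⁻¹ * ∑ j ∈ M, G w j

theorem JointlyComputable.insert_attend {S : Set (Feature α)} (h : JointlyComputable S)
    {a b c G : Feature α} (ha : a ∈ S) (hb : b ∈ S) (hc : c ∈ S) (hG : G ∈ S) :
    JointlyComputable (insert (attend a b c G) S) := by
  obtain ⟨d, e, T, f, p, h⟩ := h
  obtain ⟨ℓa, ha⟩ := h a ha
  obtain ⟨ℓb, hb⟩ := h b hb
  obtain ⟨ℓc, hc⟩ := h c hc
  obtain ⟨ℓG, hG⟩ := h G hG
  refine ⟨d, e + 1, T.snoc (.standard false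
    (affineCons ℓa (affineCons (AffineMap.const ℝ _ 1) (AffineMap.const ℝ _ 0)))
    (affineCons ℓb (affineCons ℓc (AffineMap.const ℝ _ 0)))
    (affineCons (ℓG.comp AffineMap.snd) AffineMap.fst)), f, p, ?_⟩
  rintro H (rfl | hH)
  · refine ⟨(LinearMap.proj 0).toAffineMap, fun w i => ?_⟩
    simp only [AHAT.snoc_apply, Layer.apply, affineCons_apply, LinearMap.coe_toAffineMap,
      LinearMap.proj_apply, Matrix.cons_val_zero, AffineMap.comp_apply, AffineMap.coe_snd,
      averageAttention, affineMap_average _ (maximizers_nonempty _ _ _ _ _)]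
    simp [attend, maximizers, visible, score, ha, hb, hc, hG]
  · obtain ⟨ℓH, hH⟩ := h H hH
    exact ⟨ℓH.comp (affineTail _), fun w i => by simp [Layer.apply, hH]⟩

theorem Realizable.affine {F G : Feature α} (hF : Realizable F) (hG : Realizable G) (x y z : ℝ) :
    Realizable fun w i => x * F w i + y * G w i + z := fun _ hS =>
  ((hG _ (hF _ hS)).insert_affine (by simp) (by simp) x y z).mono
    (Set.insert_subset_insert fun _ h => by simp [h])

theorem Realizable.relu {F : Feature α} (hF : Realizable F) :
    Realizable fun w i => max 0 (F w i) := fun _ hS =>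
  ((hF _ hS).insert_relu (by simp)).mono (Set.insert_subset_insert fun _ h => by simp [h])

theorem Realizable.attend {a b c G : Feature α} (ha : Realizable a) (hb : Realizable b)
    (hc : Realizable c) (hG : Realizable G) : Realizable (attend a b c G) := fun _ hS =>
  ((hG _ (hc _ (hb _ (ha _ hS)))).insert_attend (a := a) (b := b) (c := c) (G := G)
    (by simp) (by simp) (by simp) (by simp)).mono
    (Set.insert_subset_insert fun _ h => by simp [h])

theorem realizable_letter (φ : α → ℝ) : Realizable fun w i => φ (w.get i) := by
  simpa using realizable_input φ fun _ _ => 0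

theorem realizable_position (ψ : ℕ → ℕ → ℝ) :
    Realizable fun (w : List α) i => ψ i w.length := by
  simpa using realizable_input (α := α) (fun _ => 0) ψ

/-- `min x y = x - max 0 (x - y)`. -/
theorem Realizable.min {F G : Feature α} (hF : Realizable F) (hG : Realizable G) :
    Realizable fun w i => min (F w i) (G w i) := by
  convert hF.affine (hF.affine hG 1 (-1) 0).relu 1 (-1) 0 using 3 with w i
  rcases le_total (F w i) (G w i) with h | h
  · rw [min_eq_left h, max_eq_left] <;> linarith
  · rw [min_eq_right h, max_eq_right] <;> linarith

theorem Realizable.sum {ι : Type*} (s : Finset ι) {F : ι → Feature α}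
    (hF : ∀ k ∈ s, Realizable (F k)) : Realizable fun w i => ∑ k ∈ s, F k w i := by
  classical
  induction s using Finset.induction_on with
  | empty => simpa using realizable_position (α := α) fun _ _ => 0
  | insert k s hk ih =>
    have := (hF k (by simp)).affine (ih fun l hl => hF l (by simp [hl])) 1 1 0
    simpa [Finset.sum_insert hk] using this

/-! ### Properties of words recognized by features -/

/-- The sign of the feature `F` decides, at every position of a word, whether the word has the
property `P`. -/
def Feature.Decides (F : Feature α) (P : List α → Prop) : Prop :=
  ∀ (w : List α) (i : Fin w.length), (P w → 0 < F w i) ∧ (¬ P w → F w i < 0)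

/-- `P` is decided by the sign of a realizable feature. -/
def Recognizable (P : List α → Prop) : Prop :=
  ∃ F : Feature α, Realizable F ∧ F.Decides P

theorem Recognizable.acceptedByAHAT {L : Language α} (h : Recognizable (· ∈ L)) :
    AcceptedByAHAT L := by
  obtain ⟨F, hF, hL⟩ := h
  obtain ⟨d, e, T, f, p, h⟩ := hF _ jointlyComputable_empty
  obtain ⟨ℓ, hℓ⟩ := h F (by simp)
  -- A last layer replaces the affine readout `ℓ` by a single coordinate.
  let T' : AHAT d 1 := T.snoc (.standard false 0 0 ((affineCons ℓ 0).comp AffineMap.fst))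
  refine ⟨d, 1, T', f, p, fun _ => 1, fun w hw => ?_⟩
  have hT : T'.value f p (fun _ => 1) w hw = F w ⟨0, List.length_pos_of_ne_nil hw⟩ := by
    rw [hℓ]
    simp only [AHAT.value, T', AHAT.snoc_apply, Layer.apply]
    simp [dotProduct]
    rfl
  rw [hT]
  exact hL w _

/-- The empty word has no positions, so it is irrelevant for recognizability. -/
theorem Recognizable.congr {P Q : List α → Prop} (h : Recognizable P)
    (hPQ : ∀ w ≠ [], P w ↔ Q w) : Recognizable Q := by
  obtain ⟨F, hF, h⟩ := h
  refine ⟨F, hF, fun w i => ?_⟩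
  rw [← hPQ w (by rintro rfl; exact i.elim0)]
  exact h w i

theorem Recognizable.not {P : List α → Prop} (h : Recognizable P) :
    Recognizable fun w => ¬ P w := by
  obtain ⟨F, hF, h⟩ := h
  refine ⟨_, hF.affine hF (-1) 0 0, fun w i => ⟨fun hP => ?_, fun hP => ?_⟩⟩
  · linarith [(h w i).2 hP]
  · linarith [(h w i).1 (not_not.1 hP)]

theorem Recognizable.and {P Q : List α → Prop} (hP : Recognizable P) (hQ : Recognizable Q) :
    Recognizable fun w => P w ∧ Q w := by
  obtain ⟨F, hF, hP⟩ := hP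
  obtain ⟨G, hG, hQ⟩ := hQ
  refine ⟨_, hF.min hG, fun w i => ⟨fun h => lt_min ((hP w i).1 h.1) ((hQ w i).1 h.2),
    fun h => min_lt_iff.2 ?_⟩⟩
  by_cases hw : P w
  · exact .inr ((hQ w i).2 fun hq => h ⟨hw, hq⟩)
  · exact .inl ((hP w i).2 hw)

theorem Recognizable.or {P Q : List α → Prop} (hP : Recognizable P) (hQ : Recognizable Q) :
    Recognizable fun w => P w ∨ Q w :=
  (hP.not.and hQ.not).not.congr fun w _ => by tauto

theorem Recognizable.exists_mem {ι : Type*} {s : Set ι} (hs : s.Finite) {P : ι → List α → Prop}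
    (hP : ∀ k ∈ s, Recognizable (P k)) : Recognizable fun w => ∃ k ∈ s, P k w := by
  induction s, hs using Set.Finite.induction_on with
  | empty => exact ⟨_, realizable_position fun _ _ => -1, fun w i => by simp⟩
  | @insert k₀ _ _ _ ih =>
    exact ((hP k₀ (by simp)).or (ih fun k hk => hP k (by simp [hk]))).congr fun w _ => by simp

theorem Recognizable.forall_mem {ι : Type*} {s : Set ι} (hs : s.Finite) {P : ι → List α → Prop}
    (hP : ∀ k ∈ s, Recognizable (P k)) : Recognizable fun w => ∀ k ∈ s, P k w :=
  (exists_mem hs fun k hk => (hP k hk).not).not.congr fun w _ => by simp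

theorem recognizable_length (P : ℕ → Prop) : Recognizable fun w : List α => P w.length := by
  classical
  refine ⟨_, realizable_position fun _ n => if P n then 1 else -1, fun w i => ?_⟩
  constructor <;> intro h <;> simp [h]

/-! ### Linear inequalities and functions of one letter count -/

section Count

variable [DecidableEq α]

theorem realizable_frequency (a : α) :
    Realizable fun w _ => (w.count a : ℝ) / w.length := by
  have hz : Realizable (α := α) fun _ _ => 0 := realizable_position fun _ _ => 0
  -- All scores vanish, so the attention averages over the whole word.
  convert hz.attend hz hz (realizable_letter fun x => if x = a then (1 : ℝ) else 0) using 3 with w i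
  have hcount : w.count a = ∑ j : Fin w.length, if w.get j = a then 1 else 0 := by
    have := Fin.card_filter_univ_eq_vector_get_eq_count a ⟨w, rfl⟩
    rw [Finset.card_filter] at this
    exact this.symm
  rw [hcount]
  simp [attend, div_eq_inv_mul]

/-- With `K = ∑ a ∈ s, k a * count a + c`, the deciding feature is `(K - 1 / 2) / n`: it is an
affine combination of the frequencies and `1 / n`, and since `K` is an integer, it is never `0`. -/
theorem recognizable_linear_pos (s : Finset α) (k : α → ℤ) (c : ℤ) :
    Recognizable fun w : List α => 0 < ∑ a ∈ s, k a * (w.count a : ℤ) + c := by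
  have hsum : Realizable fun (w : List α) _ => ∑ a ∈ s, k a * ((w.count a : ℝ) / w.length) :=
    Realizable.sum _ fun a _ => by
      simpa using (realizable_frequency a).affine (realizable_frequency a) (k a) 0 0
  refine ⟨_, hsum.affine (realizable_position fun _ n => (n : ℝ)⁻¹) 1 (c - 1 / 2) 0,
    fun w i => ?_⟩
  have hn : (0 : ℝ) < w.length := by exact_mod_cast i.pos
  -- The left-hand side is the feature in the form in which `Realizable.affine` provides it.
  have hF : 1 * ∑ a ∈ s, k a * ((w.count a : ℝ) / w.length) + (c - 1 / 2) * (w.length : ℝ)⁻¹ + 0 =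
      (((∑ a ∈ s, k a * (w.count a : ℤ) + c : ℤ) : ℝ) - 1 / 2) / w.length := by
    push_cast
    simp only [mul_div_assoc', ← Finset.sum_div]
    ring
  rw [hF]
  change (0 < _ → _) ∧ (¬ 0 < _ → _)
  generalize ∑ a ∈ s, k a * (w.count a : ℤ) + c = K
  constructor
  · intro hK
    have : (1 : ℝ) ≤ K := by exact_mod_cast hK
    exact div_pos (by linarith) hn
  · intro hK
    have : (K : ℝ) ≤ 0 := by exact_mod_cast not_lt.1 hK
    exact div_neg_of_neg_of_pos (by linarith) hn

/-- A word of length `n` has only `n` positions for the `n + 1` possible numbers of occurrences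
of `a`, so the position with index `j` stands for `j + 1` occurrences and stores whether
`P (j + 1) n` holds. The score `2 * count a * (j + 1) - (j + 1) ^ 2`, divided by `n ^ 2`, has a
unique maximum, namely at `j + 1 = count a`, or at `j + 1 = 1` if `a` does not occur. -/
theorem recognizable_lookup (a : α) (P : ℕ → ℕ → Prop) :
    Recognizable fun w : List α => P (max (w.count a) 1) w.length := by
  classical
  refine ⟨_, (realizable_frequency a).attend
    (realizable_position fun j n => 2 * ((j : ℝ) + 1) / n)
    (realizable_position fun j n => -((j : ℝ) + 1) ^ 2 / n ^ 2)
    (realizable_position fun j n => if P (j + 1) n then 1 else -1), fun w i => ?_⟩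
  have hn : (0 : ℝ) < w.length := by exact_mod_cast i.pos
  have hc : w.count a ≤ w.length := List.count_le_length
  obtain ⟨m, hm⟩ : ∃ m : Fin w.length, m.val + 1 = max (w.count a) 1 :=
    ⟨⟨max (w.count a) 1 - 1, by have := i.pos; omega⟩, by simp⟩
  have hscore (j : Fin w.length) : (w.count a : ℝ) / w.length * (2 * ((j : ℝ) + 1) / w.length) +
      -((j : ℝ) + 1) ^ 2 / w.length ^ 2 =
      ((w.count a : ℝ) ^ 2 - ((w.count a : ℝ) - (j + 1)) ^ 2) / w.length ^ 2 := by
    field_simp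
    ring
  have hlt (j : Fin w.length) (hj : j ≠ m) :
      ((w.count a : ℝ) - (m + 1)) ^ 2 < ((w.count a : ℝ) - (j + 1)) ^ 2 := by
    have hj' : (j : ℕ) ≠ m := fun h => hj (Fin.ext h)
    have : ((w.count a : ℤ) - (m + 1)) ^ 2 < ((w.count a : ℤ) - (j + 1)) ^ 2 := by
      rcases Nat.eq_zero_or_pos (w.count a) with h0 | h0
      · have hm0 : (m : ℕ) = 0 := by omega
        rw [h0, hm0]
        have : (1 : ℤ) ≤ j := by omega
        push_cast
        nlinarith
      · have hm0 : (w.count a : ℤ) - (m + 1) = 0 := by omega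
        rw [hm0]
        have : (w.count a : ℤ) - (j + 1) ≠ 0 := by omega
        positivity
    exact_mod_cast this
  have hM : ({j | ∀ k : Fin w.length, ((w.count a : ℝ) ^ 2 - ((w.count a : ℝ) - (k + 1)) ^ 2) /
      w.length ^ 2 ≤ ((w.count a : ℝ) ^ 2 - ((w.count a : ℝ) - (j + 1)) ^ 2) / w.length ^ 2} :
      Finset (Fin w.length)) = {m} := by
    ext j
    simp only [Finset.mem_filter, Finset.mem_univ, true_and, Finset.mem_singleton,
      div_le_div_iff_of_pos_right (pow_pos hn 2), sub_le_sub_iff_left]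
    constructor
    · intro h
      by_contra hj
      exact (hlt j hj).not_ge (h m)
    · rintro rfl k
      by_cases hk : k = j
      · rw [hk]
      · exact (hlt k hk).le
  simp only [attend, hscore, hM, ← hm]
  constructor <;> intro h <;> simp [h]

/-- The value `0`, which `recognizable_lookup` cannot tell from `1`, is treated separately. -/
theorem recognizable_count (a : α) (P : ℕ → ℕ → Prop) :
    Recognizable fun w : List α => P (w.count a) w.length := by
  have hpos : Recognizable fun w : List α => 0 < w.count a :=
    (recognizable_linear_pos {a} 1 0).congr fun w _ => by simp
  refine ((hpos.and (recognizable_lookup a P)).or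
    (hpos.not.and (recognizable_length (P 0)))).congr fun w _ => ?_
  rcases Nat.eq_zero_or_pos (w.count a) with h | h
  · simp [h]
  · simp [h, max_eq_left (Nat.succ_le_of_lt h)]

end Count

/-! ### Semilinear sets of letter counts -/

section Semilinear

open Pointwise

/-- The rational vector with the given natural coordinates. -/
def toRat : (α → ℕ) →+ (α → ℚ) :=
  (Nat.castAddMonoidHom ℚ).compLeft α

theorem toRat_apply (x : α → ℕ) (a : α) : toRat x a = x a := rfl

theorem toRat_injective : Function.Injective (toRat : (α → ℕ) → (α → ℚ)) := fun x y h => by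
  ext a
  simpa [toRat_apply] using congr_fun h a

theorem linearIndepOn_toRat {t : Set (α → ℕ)} (ht : LinearIndepOn ℕ id t) :
    LinearIndepOn ℚ toRat t := by
  rw [LinearIndepOn, ← LinearIndependent.iff_fractionRing ℤ ℚ, ← LinearIndepOn, linearIndepOn_iff'']
  intro u f hu hf heq i hi
  rw [linearIndepOn_iff_linearIndepOn_finset] at ht
  specialize ht u hu
  rw [linearIndepOn_finset_iffₛ] at ht
  -- Separate the coefficients into their positive and negative parts.
  specialize ht (Int.toNat ∘ f) (Int.toNat ∘ (-·) ∘ f) ?_ i hi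
  · apply toRat_injective
    simp_rw [map_sum]
    rw [← sub_eq_zero, ← Finset.sum_sub_distrib, ← heq]
    refine Finset.sum_congr rfl fun j hj => ?_
    conv_rhs => rw [← (f j).toNat_sub_toNat_neg]
    simp only [sub_smul, map_nsmul, natCast_zsmul, Function.comp_apply, id_eq]
  · rw [← (f i).toNat_sub_toNat_neg, sub_eq_zero, Int.natCast_inj]
    simpa using ht

variable [DecidableEq α] [Fintype α]

theorem recognizable_linear_eq_zero (k : α → ℤ) (c : ℤ) :
    Recognizable fun w : List α => ∑ a, k a * (w.count a : ℤ) + c = 0 := by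
  refine ((recognizable_linear_pos Finset.univ k c).not.and
    (recognizable_linear_pos Finset.univ (-k) (-c)).not).congr fun w _ => ?_
  simp only [Pi.neg_apply, neg_mul, Finset.sum_neg_distrib]
  omega

/-- Divisibility of `∑ a, k a * count a + c` by `D` depends on the residues of the counts. -/
theorem recognizable_linear_dvd (D : ℕ) [NeZero D] (k : α → ℤ) (c : ℤ) :
    Recognizable fun w : List α => (D : ℤ) ∣ ∑ a, k a * (w.count a : ℤ) + c := by
  refine (Recognizable.exists_mem
    (s := {r : α → ZMod D | ∑ a, (k a : ZMod D) * r a + (c : ZMod D) = 0}) (Set.toFinite _)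
    (P := fun r w => ∀ a ∈ Set.univ, (w.count a : ZMod D) = r a) fun r _ =>
      Recognizable.forall_mem Set.finite_univ fun a _ =>
        recognizable_count a fun m _ => (m : ZMod D) = r a).congr fun w _ => ?_
  rw [← ZMod.intCast_zmod_eq_zero_iff_dvd]
  push_cast
  constructor
  · rintro ⟨r, hr, h⟩
    simpa [fun a => h a (Set.mem_univ a)] using hr
  · exact fun h => ⟨fun a => w.count a, h, fun _ _ => rfl⟩

/-- Clearing denominators in a rational affine form. -/
theorem exists_integral_form (f : (α → ℚ) →ₗ[ℚ] ℚ) (c : ℚ) :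
    ∃ D : ℕ, 0 < D ∧ ∃ (k : α → ℤ) (c' : ℤ), ∀ x : α → ℕ,
      (D : ℚ) * (f (toRat x) + c) = (∑ a, k a * (x a : ℤ) + c' : ℤ) := by
  obtain ⟨b, hb⟩ := IsLocalization.exist_integer_multiples_of_finite (nonZeroDivisors ℤ)
    (fun o : Option α => o.elim c fun a => f (Pi.single a 1))
  choose g hg using hb
  have hb0 : (b : ℤ) ≠ 0 := nonZeroDivisors.ne_zero b.2
  refine ⟨(b : ℤ).natAbs, Int.natAbs_pos.2 hb0, fun a => (b : ℤ).sign * g (some a),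
    (b : ℤ).sign * g none, fun x => ?_⟩
  have hD : (((b : ℤ).natAbs : ℕ) : ℚ) = (((b : ℤ).sign : ℤ) : ℚ) * ((b : ℤ) : ℚ) := by
    rw [← Int.cast_mul, Int.sign_mul_self_eq_natAbs]
    rfl
  have hx : f (toRat x) = ∑ a, (x a : ℚ) * f (Pi.single a 1) := by
    conv_lhs => rw [pi_eq_sum_univ' (toRat x), map_sum]
    simp only [map_smul, toRat_apply, smul_eq_mul]
  have h0 : ((g none : ℤ) : ℚ) = (b : ℤ) * c := by simpa using hg none
  have h1 (a : α) : ((g (some a) : ℤ) : ℚ) = (b : ℤ) * f (Pi.single a 1) := by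
    simpa using hg (some a)
  push_cast
  rw [hD, hx]
  simp only [h0, h1, mul_add, Finset.mul_sum]
  congr 1
  · exact Finset.sum_congr rfl fun a _ => by ring
  · ring

theorem recognizable_rational_eq_zero (f : (α → ℚ) →ₗ[ℚ] ℚ) (c : ℚ) :
    Recognizable fun w : List α => f (toRat (parikh w)) + c = 0 := by
  obtain ⟨D, hD, k, c', h⟩ := exists_integral_form f c
  refine (recognizable_linear_eq_zero k c').congr fun w _ => ?_
  have hD' : (D : ℚ) ≠ 0 := by exact_mod_cast hD.ne'
  rw [← mul_right_inj' hD', mul_zero, h, Int.cast_eq_zero]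
  rfl

theorem recognizable_rational_eq_natCast (f : (α → ℚ) →ₗ[ℚ] ℚ) (c : ℚ) :
    Recognizable fun w : List α => ∃ n : ℕ, f (toRat (parikh w)) + c = n := by
  obtain ⟨D, hD, k, c', h⟩ := exists_integral_form f c
  have : NeZero D := ⟨hD.ne'⟩
  refine ((recognizable_linear_pos Finset.univ k (c' + 1)).and
    (recognizable_linear_dvd D k c')).congr fun w _ => ?_
  have hD' : (D : ℚ) ≠ 0 := by exact_mod_cast hD.ne'
  have hn (n : ℕ) : f (toRat (parikh w)) + c = n ↔
      ∑ a, k a * (parikh w a : ℤ) + c' = D * n := by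
    rw [← mul_right_inj' hD', h]
    exact_mod_cast Iff.rfl
  simp only [hn]
  change 0 < ∑ a, k a * (parikh w a : ℤ) + (c' + 1) ∧ (D : ℤ) ∣ ∑ a, k a * (parikh w a : ℤ) + c' ↔ _
  rw [← add_assoc]
  generalize ∑ a, k a * (parikh w a : ℤ) + c' = K
  constructor
  · rintro ⟨hK, m, rfl⟩
    have hm : 0 ≤ m := by
      by_contra hm
      have : (1 : ℤ) ≤ D := by exact_mod_cast hD
      nlinarith
    lift m to ℕ using hm
    exact ⟨m, rfl⟩
  · rintro ⟨m, hK⟩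
    exact ⟨by rw [hK]; positivity, m, hK⟩

/-- Since the periods are linearly independent, the coefficients of a vector with respect to them
are rational linear forms `ψ`; the vector lies in the set iff it is the combination of the periods
with these coefficients, and they are natural numbers. -/
theorem recognizable_of_isProperLinearSet {X : Set (α → ℕ)} (hX : IsProperLinearSet X) :
    Recognizable fun w : List α => parikh w ∈ X := by
  obtain ⟨b, t, ht, hind, rfl⟩ := hX
  have := ht.fintype
  let φ : (t → ℚ) →ₗ[ℚ] (α → ℚ) := Fintype.linearCombination ℚ fun p : t => toRat p.1
  have hφ : LinearMap.ker φ = ⊥ :=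
    LinearMap.ker_eq_bot.2 (linearIndepOn_toRat hind).fintypeLinearCombination_injective
  obtain ⟨ψ, hψ⟩ := φ.exists_leftInverse_of_injective hφ
  have hψ' (v : t → ℚ) : ψ (φ v) = v := LinearMap.congr_fun hψ v
  refine ((Recognizable.forall_mem Set.finite_univ fun a _ => recognizable_rational_eq_zero
      (LinearMap.proj a ∘ₗ (φ ∘ₗ ψ - LinearMap.id)) (-(φ (ψ (toRat b)) - toRat b) a)).and
    (Recognizable.forall_mem Set.finite_univ fun p _ => recognizable_rational_eq_natCast
      (LinearMap.proj p ∘ₗ ψ) (-ψ (toRat b) p))).congr fun w _ => ?_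
  generalize parikh w = x
  have hcomb (m : t → ℕ) : φ (fun p => (m p : ℚ)) = toRat (∑ p, m p • p.1) := by
    simp only [φ, Fintype.linearCombination_apply, Nat.cast_smul_eq_nsmul, map_sum, map_nsmul]
  constructor
  · rintro ⟨h₁, h₂⟩
    choose m hm using fun p => h₂ p (Set.mem_univ p)
    have hm' : ψ (toRat x) - ψ (toRat b) = fun p => (m p : ℚ) := by
      ext p
      simpa [sub_eq_add_neg] using hm p
    have hx : toRat x - toRat b = φ (ψ (toRat x) - ψ (toRat b)) := by
      ext a
      have := h₁ a (Set.mem_univ a)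
      simp at this ⊢
      linarith
    rw [hm', hcomb, sub_eq_iff_eq_add, ← map_add] at hx
    rw [toRat_injective hx, add_comm]
    refine Set.vadd_mem_vadd_set (sum_mem fun p _ => nsmul_mem ?_ _)
    exact AddSubmonoid.subset_closure p.2
  · rintro ⟨y, hy, rfl⟩
    obtain ⟨m, rfl⟩ : ∃ m : t → ℕ, y = ∑ p, m p • p.1 := by
      induction hy using AddSubmonoid.closure_induction with
      | mem y hy =>
        classical
        exact ⟨Pi.single ⟨y, hy⟩ 1, by simp [Pi.single_apply, ite_smul]⟩
      | zero => exact ⟨0, by simp⟩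
      | add y z _ _ hy hz =>
        obtain ⟨m, rfl⟩ := hy
        obtain ⟨m', rfl⟩ := hz
        exact ⟨m + m', by simp [add_smul, Finset.sum_add_distrib]⟩
    simp only [vadd_eq_add, map_add, ← hcomb, hψ', LinearMap.comp_apply, LinearMap.sub_apply,
      LinearMap.id_apply, LinearMap.proj_apply, Pi.sub_apply]
    exact ⟨fun a _ => by ring, fun p _ => ⟨m p, by ring⟩⟩

theorem recognizable_of_isSemilinearSet {X : Set (α → ℕ)} (hX : IsSemilinearSet X) :
    Recognizable fun w : List α => parikh w ∈ X := by
  obtain ⟨S, hS, hS', rfl⟩ := hX.isProperSemilinearSet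
  exact (Recognizable.exists_mem hS fun s hs => recognizable_of_isProperLinearSet (hS' s hs)).congr
    fun w _ => by simp

end Semilinear

/-! ### The Parikh image of a regular language -/

section Parikh

open Pointwise

variable [DecidableEq α] {σ : Type*}

theorem parikh_nil : parikh ([] : List α) = 0 := by
  ext b
  simp [parikh]

theorem parikh_append (v w : List α) : parikh (v ++ w) = parikh v + parikh w := by
  ext b
  simp [parikh]

theorem parikh_singleton (a : α) : parikh [a] = Pi.single a 1 := by
  ext b
  simp [parikh, List.count_singleton, Pi.single_apply, eq_comm (a := a)]

/-- The Parikh vectors of the runs of `M` from `i` to `j` all of whose intermediate states are in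
`K`, computed by Kleene's recursion on `K`. -/
def runVectors (M : DFA α σ) : List σ → σ → σ → Set (α → ℕ)
  | [], i, j => {x | ∃ a, M.step i a = j ∧ Pi.single a 1 = x} ∪ {x | i = j ∧ 0 = x}
  | k :: K, i, j => runVectors M K i j ∪
      (runVectors M K i k + (AddSubmonoid.closure (runVectors M K k k) : Set (α → ℕ)) +
        runVectors M K k j)

theorem isSemilinearSet_runVectors [Finite α] (M : DFA α σ) (K : List σ) (i j : σ) :
    IsSemilinearSet (runVectors M K i j) := by
  induction K generalizing i j with
  | nil =>
    refine .of_finite (.union (Set.Finite.subset (Set.finite_range fun a => Pi.single a 1) ?_)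
      (Set.Finite.subset (Set.finite_singleton 0) ?_))
    · rintro x ⟨a, -, rfl⟩
      exact ⟨a, rfl⟩
    · rintro x ⟨-, rfl⟩
      rfl
  | cons k K ih => exact (ih i j).union (((ih i k).add (ih k k).closure).add (ih k j))

/-- The vectors in `runVectors` belong to actual runs. -/
theorem exists_parikh_eq_of_mem_runVectors (M : DFA α σ) {K : List σ} {i j : σ} {x : α → ℕ}
    (hx : x ∈ runVectors M K i j) : ∃ w, M.evalFrom i w = j ∧ parikh w = x := by
  induction K generalizing i j x with
  | nil =>
    rcases hx with ⟨a, rfl, rfl⟩ | ⟨rfl, rfl⟩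
    · exact ⟨[a], rfl, parikh_singleton a⟩
    · exact ⟨[], rfl, parikh_nil⟩
  | cons k K ih =>
    have hcl {c : α → ℕ} (hc : c ∈ AddSubmonoid.closure (runVectors M K k k)) :
        ∃ w, M.evalFrom k w = k ∧ parikh w = c := by
      induction hc using AddSubmonoid.closure_induction with
      | mem c hc => exact ih hc
      | zero => exact ⟨[], rfl, parikh_nil⟩
      | add c d _ _ hc hd =>
        obtain ⟨u, hu, rfl⟩ := hc
        obtain ⟨v, hv, rfl⟩ := hd
        exact ⟨u ++ v, by rw [M.evalFrom_of_append, hu, hv], parikh_append u v⟩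
    rcases hx with hx | ⟨_, ⟨y, hy, c, hc, rfl⟩, z, hz, rfl⟩
    · exact ih hx
    · obtain ⟨u, hu, rfl⟩ := ih hy
      obtain ⟨v, hv, rfl⟩ := hcl hc
      obtain ⟨w, hw, rfl⟩ := ih hz
      exact ⟨u ++ v ++ w, by simp only [M.evalFrom_of_append, hu, hv, hw],
        by simp only [parikh_append]⟩

/-- Runs can be concatenated at any state that is allowed as an intermediate state. For the state
`k` added last, the two halves of the sum contribute loops at `k`; for `m ∈ K`, the pieces adjacent
to `m` are concatenated by induction. -/
theorem add_mem_runVectors (M : DFA α σ) {K : List σ} {i m j : σ} (hm : m ∈ K) {x y : α → ℕ}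
    (hx : x ∈ runVectors M K i m) (hy : y ∈ runVectors M K m j) :
    x + y ∈ runVectors M K i j := by
  induction K generalizing i m j x y with
  | nil => simp at hm
  | cons k K ih =>
    have mk {p c q : α → ℕ} (hp : p ∈ runVectors M K i k)
        (hc : c ∈ AddSubmonoid.closure (runVectors M K k k)) (hq : q ∈ runVectors M K k j) :
        p + c + q ∈ runVectors M (k :: K) i j :=
      .inr (Set.add_mem_add (Set.add_mem_add hp hc) hq)
    have hsub {c : α → ℕ} (hc : c ∈ runVectors M K k k) :
        c ∈ AddSubmonoid.closure (runVectors M K k k) := AddSubmonoid.subset_closure hc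
    rcases List.mem_cons.1 hm with rfl | hm
    · rcases hx with hx | ⟨_, ⟨p, hp, c, hc, rfl⟩, q, hq, rfl⟩ <;>
      rcases hy with hy | ⟨_, ⟨p', hp', c', hc', rfl⟩, q', hq', rfl⟩
      · simpa using mk hx (zero_mem _) hy
      · convert mk hx (add_mem (hsub hp') hc') hq' using 1
        simp only [add_assoc]
      · convert mk hp (add_mem hc (hsub hq)) hy using 1
        simp only [add_assoc]
      · convert mk hp (add_mem (add_mem hc (hsub hq)) (add_mem (hsub hp') hc')) hq' using 1
        simp only [add_assoc]
    · rcases hx with hx | ⟨_, ⟨p, hp, c, hc, rfl⟩, q, hq, rfl⟩ <;>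
      rcases hy with hy | ⟨_, ⟨p', hp', c', hc', rfl⟩, q', hq', rfl⟩
      · exact .inl (ih hm hx hy)
      · convert mk (ih hm hx hp') hc' hq' using 1
        simp only [add_assoc]
      · convert mk hp hc (ih hm hq hy) using 1
        simp only [add_assoc]
      · convert mk hp (add_mem (add_mem hc (hsub (ih hm hq hp'))) hc') hq' using 1
        simp only [add_assoc]

/-- If all states are allowed as intermediate states, then every run is counted. -/
theorem parikh_mem_runVectors (M : DFA α σ) {K : List σ} (hK : ∀ k, k ∈ K) (i : σ) (w : List α) :
    parikh w ∈ runVectors M K i (M.evalFrom i w) := by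
  have hbase {i j : σ} {x : α → ℕ} (hx : x ∈ runVectors M [] i j) (K : List σ) :
      x ∈ runVectors M K i j := by
    induction K with
    | nil => exact hx
    | cons k K ih => exact .inl ih
  induction w generalizing i with
  | nil => exact hbase (.inr ⟨rfl, parikh_nil.symm⟩) K
  | cons a w ih =>
    rw [← List.singleton_append, parikh_append, List.singleton_append, M.evalFrom_cons]
    exact add_mem_runVectors M (hK _) (hbase (.inl ⟨a, rfl, (parikh_singleton a).symm⟩) K) (ih _)

/-- Parikh's theorem for regular languages. -/
theorem isSemilinearSet_parikh_image [Finite α] {L : Language α} (hL : L.IsRegular) :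
    IsSemilinearSet (parikh '' {w | w ∈ L}) := by
  obtain ⟨σ, _, M, rfl⟩ := hL
  convert IsSemilinearSet.biUnion (Set.toFinite M.accept) fun j _ =>
    isSemilinearSet_runVectors M Finset.univ.toList M.start j using 1
  ext x
  simp only [Set.mem_image, Set.mem_iUnion, exists_prop]
  constructor
  · rintro ⟨w, hw, rfl⟩
    exact ⟨_, hw, parikh_mem_runVectors M (by simp) _ w⟩
  · rintro ⟨j, hj, hx⟩
    obtain ⟨w, rfl, rfl⟩ := exists_parikh_eq_of_mem_runVectors M hx
    exact ⟨w, hj, rfl⟩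

theorem recognizable_perm_of_isRegular [Fintype α] {L : Language α} (hL : L.IsRegular) :
    Recognizable fun w : List α => w ∈ perm L :=
  (recognizable_of_isSemilinearSet (isSemilinearSet_parikh_image hL)).congr fun _ _ =>
    ⟨fun ⟨v, hv, h⟩ => ⟨v, hv, h.symm⟩, fun ⟨v, hv, h⟩ => ⟨v, hv, h.symm⟩⟩

end Parikh

/-! ### Two-letter alphabets -/

/-- Over two letters, the letter counts of a word are determined by its length and the number of
occurrences of one letter. -/
theorem perm_of_count_eq_of_length_eq [Fintype α] [DecidableEq α] (hα : Fintype.card α = 2) (a : α)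
    {v w : List α} (hc : v.count a = w.count a) (hl : v.length = w.length) : v.Perm w := by
  have hlen (u : List α) : u.length = u.count a + ∑ x ∈ Finset.univ.erase a, u.count x := by
    rw [Finset.add_sum_erase _ (u.count ·) (Finset.mem_univ a)]
    have := Multiset.sum_count_eq_card (s := Finset.univ) (m := (u : Multiset α))
      fun _ _ => Finset.mem_univ _
    simpa using this.symm
  obtain ⟨b, hb⟩ := Finset.card_eq_one.1
    (show (Finset.univ.erase a).card = 1 by simp [Finset.card_erase_of_mem, hα])
  have hv := hlen v
  have hw := hlen w
  rw [hb, Finset.sum_singleton] at hv hw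
  refine List.perm_iff_count.2 fun x => ?_
  by_cases hx : x = a
  · rw [hx, hc]
  · have : x = b := Finset.mem_singleton.1 (hb ▸ Finset.mem_erase.2 ⟨hx, Finset.mem_univ x⟩)
    rw [this]
    omega

theorem recognizable_of_permutationClosed [Fintype α] [DecidableEq α] (hα : Fintype.card α = 2)
    {L : Language α} (hL : PermutationClosed L) : Recognizable fun w => w ∈ L := by
  obtain ⟨a⟩ : Nonempty α := Fintype.card_pos_iff.1 (by omega)
  refine (recognizable_count a fun c n => ∃ v ∈ L, v.count a = c ∧ v.length = n).congr
    fun w _ => ⟨?_, fun hw => ⟨w, hw, rfl, rfl⟩⟩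
  rintro ⟨v, hv, hc, hl⟩
  exact (hL v).1 hv w (perm_of_count_eq_of_length_eq hα a hc hl).symm

end HardAttention
end

theorem mainTheorem5 :
    (∀ (α : Type*) [Fintype α] [DecidableEq α] (L : Language α),
      L.IsRegular → HardAttention.AcceptedByAHAT (HardAttention.perm L)) ∧
    (∀ (α : Type*) [Fintype α] [DecidableEq α], Fintype.card α = 2 →
      (∀ L : Language α,
        HardAttention.PermutationClosed L → HardAttention.AcceptedByAHAT L) ∧
      ∀ a : α,
        HardAttention.AcceptedByAHAT (HardAttention.parity a) ∧
        HardAttention.AcceptedByAHAT (HardAttention.majority a)) := by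
  refine ⟨fun α _ _ L hL => (HardAttention.recognizable_perm_of_isRegular hL).acceptedByAHAT,
    fun α _ _ hα => ⟨fun L hL =>
      (HardAttention.recognizable_of_permutationClosed hα hL).acceptedByAHAT, fun a => ⟨?_, ?_⟩⟩⟩
  · exact HardAttention.Recognizable.acceptedByAHAT
      (HardAttention.recognizable_count a fun c _ => Even c)
  · exact HardAttention.Recognizable.acceptedByAHAT
      (HardAttention.recognizable_count a fun c n => n < 2 * c)
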